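/- Let $V$ be a separable real Hilbert space and let $\mathcal M_1(V)$ be the set of Borel probability measures on $V$ with the topology of weak convergence (metrised by the Prokhorov metric). A measure $\mu\in\mathcal M_1(V)$ is infinitely divisible if for every integer $n\ge 1$ it is the $n$-fold convolution of some element of $\mathcal M_1(V)$ with itself. Let $J$ be an arbitrary index set and let $\{\mu_\alpha:\alpha\in J\}$ be a relatively compact subset of $\mathcal M_1(V)$ consisting of infinitely divisible measures. Then for each $\alpha\in J$ there is exactly one weakly continuous convolution semigroup $(\mu_\alpha^{*t})_{t\ge 0}$ in $\mathcal M_1(V)$, that is, exactly one weakly continuous family with $\mu_\alpha^{*0}=\delta_0$ and $\mu_\alpha^{*(s+t)}=\mu_\alpha^{*s}*\mu_\alpha^{*t}$ for all $s,t\ge 0$, such that $\mu_\alpha^{*1}=\mu_\alpha$; and for every $T\in\mathbb R$ the set $$\Big\{\mu_{\alpha_1}^{*t_1}*\cdots*\mu_{\alpha_n}^{*t_n}:\ n\in\mathbb N,\ n\ge 1,\ \alpha_1,\dots,\alpha_n\in J,\ t_1,\dots,t_n\ge 0,\ t_1+\cdots+t_n\le T\Big\}$$ is relatively compact in $\mathcal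 M_1(V)$. -/

import Mathlib

open MeasureTheory Topology
open scoped NNReal

namespace InfDiv

variable {V : Type*} [NormedAddCommGroup V] [MeasurableSpace V] [BorelSpace V]
  [SecondCountableTopology V]

/-- The convolution `μ ∗ ν` of two Borel probability measures, as a probability measure. -/
noncomputable def conv (μ ν : ProbabilityMeasure V) : ProbabilityMeasure V :=
  ⟨Measure.conv (μ : Measure V) (ν : Measure V), inferInstance⟩

/-- The convolution of finitely many Borel probability measures `p 0 ∗ ⋯ ∗ p (n - 1)`;
the empty convolution is the Dirac measure at the origin. -/
noncomputable def convFin (n : ℕ) (p : Fin n → ProbabilityMeasure V) : ProbabilityMeasure V :=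
  (List.ofFn p).foldr conv (diracProba 0)

/-- `μ` is infinitely divisible: for every `n ≥ 1` it is the `n`-fold convolution of some Borel
probability measure with itself. -/
def IsInfinitelyDivisible (μ : ProbabilityMeasure V) : Prop :=
  ∀ n : ℕ, 1 ≤ n → ∃ ν : ProbabilityMeasure V, convFin n (fun _ => ν) = μ

/-- `ρ` is a weakly continuous convolution semigroup of Borel probability measures with
`ρ 1 = μ`. The topology on `ProbabilityMeasure V` is that of weak convergence. -/
structure IsConvSemigroupOf (μ : ProbabilityMeasure V) (ρ : ℝ≥0 → ProbabilityMeasure V) :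
    Prop where
  zero : ρ 0 = diracProba 0
  add : ∀ s t : ℝ≥0, ρ (s + t) = conv (ρ s) (ρ t)
  continuous : Continuous ρ
  one : ρ 1 = μ

open Classical in
/-- The convolution power `μ^{∗t}` for real `t ≥ 0`: the value at time `t` of the weakly continuous
convolution semigroup with value `μ` at time `1` (and the Dirac measure at the origin if there is
no such semigroup). -/
noncomputable def convPow (μ : ProbabilityMeasure V) (t : ℝ≥0) : ProbabilityMeasure V :=
  if h : ∃ ρ : ℝ≥0 → ProbabilityMeasure V, IsConvSemigroupOf μ ρ then h.choose t
  else diracProba 0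

end InfDiv

/-!
Write `φ` for characteristic functions. If `μ` is infinitely divisible, then `φ_μ` has no zeros, and
since `V` is simply connected it lifts through the covering `exp` to `φ_μ = exp η` with `η`
continuous and `η 0 = 0` (`IsInfinitelyDivisible.exists_isCharExponent`); continuous roots being
unique, the `n`-th convolution root of `μ` has characteristic function `exp (η / n)`. A convolution
semigroup through `μ` must have characteristic functions `exp (t η)`
(`IsConvSemigroupOf.charFun_eq`). So everything reduces to one tightness statement,
`isTightMeasureSet_exponentFamily`: if the `μ_α` are tight, then so are the measures with
characteristic function `exp (∑ t_i η_{α_i})`, `∑ t_i ≤ T`. By Prokhorov's theorem it provides limit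
points of the rational powers of `μ`, hence the existence and the continuity of the semigroup, and
it contains the compactness claim.

Tightness is proved without the Lévy–Khintchine representation, in two steps.

* *Symmetrized measures.* If `K` is compact and `μ_α(Kᶜ) ≤ ε` for all `α`, then
  `-Re η_α(u) ≤ 4 ε + 5 ∫_K ⟪x, u⟫² dμ_α` for all `u` (`IsCharExponent.neg_re_le`): for small
  values of the integral this is a bound on a logarithm, and `-Re η_α (2 u) ≤ -4 Re η_α(u)`
  propagates it. Such bounds are additive in the exponent, so for `ν` in the family
  `1 - |φ_ν(u)|²` is at most `8 T ε` plus the quadratic form of second moments of a measure on `K`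
  of mass at most `10 T`. Averaging over a Gaussian vector `u` in a finite-dimensional space nearly
  orthogonal to `K` (`measureReal_norm_ge_le`) bounds the mass that the symmetrization of `ν` has
  far from a finite-dimensional space, which is tightness in a Hilbert space
  (`isTightMeasureSet_of_finiteDimensional_approx`).
* *Translations.* Consequently some translate of `ν` by a vector `z` has almost full mass on a
  compact set. Since `|η_α(u)|` is small when `|⟪·, u⟫|` is small on a large compact set
  (`IsCharExponent.norm_le`), both `φ_ν(u)` and `φ_ν(u) exp (i ⟪z, u⟫)` are close to `1` for all
  such `u`; hence `⟪z, u⟫` is bounded for these `u`, which confines `z` to a compact set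
  (`isCompact_polar_hull`).
-/

namespace InfDiv

open Complex Filter ProbabilityTheory
open scoped RealInnerProductSpace ENNReal Pointwise

/-! ### Characteristic functions and symmetrization -/

section CharFun

variable {V : Type*} [NormedAddCommGroup V] [InnerProductSpace ℝ V] [MeasurableSpace V]
  [BorelSpace V] [SecondCountableTopology V]

lemma integrable_exp_inner (μ : Measure V) [IsFiniteMeasure μ] (u : V) :
    Integrable (fun x : V ↦ exp (⟪x, u⟫ * I)) μ := by
  refine (integrable_const (1 : ℝ)).mono' (by fun_prop) (ae_of_all _ fun x ↦ ?_)
  simp [norm_exp_ofReal_mul_I]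

lemma re_charFun (μ : Measure V) [IsFiniteMeasure μ] (u : V) :
    (charFun μ u).re = ∫ x, Real.cos ⟪x, u⟫ ∂μ := by
  rw [charFun_apply]
  have h := integral_re (𝕜 := ℂ) (integrable_exp_inner μ u)
  simp only [RCLike.re_to_complex] at h
  rw [← h]
  simp [exp_ofReal_mul_I_re]

lemma integrable_cos_inner (μ : Measure V) [IsFiniteMeasure μ] (u : V) :
    Integrable (fun x : V ↦ Real.cos ⟪x, u⟫) μ := by
  refine (integrable_const (1 : ℝ)).mono' (by fun_prop) (ae_of_all _ fun x ↦ ?_)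
  simpa using Real.abs_cos_le_one _

lemma one_sub_re_charFun (μ : Measure V) [IsProbabilityMeasure μ] (u : V) :
    1 - (charFun μ u).re = ∫ x, (1 - Real.cos ⟪x, u⟫) ∂μ := by
  rw [re_charFun, integral_sub (integrable_const _) (integrable_cos_inner μ u)]
  simp

lemma one_sub_re_charFun_two_smul_le (μ : Measure V) [IsProbabilityMeasure μ] (u : V) :
    1 - (charFun μ ((2 : ℝ) • u)).re ≤ 4 * (1 - (charFun μ u).re) := by
  rw [one_sub_re_charFun, one_sub_re_charFun, ← integral_const_mul]
  refine integral_mono ((integrable_const _).sub (integrable_cos_inner μ _))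
    (((integrable_const _).sub (integrable_cos_inner μ _)).const_mul _) fun x ↦ ?_
  simp only [real_inner_smul_right, Real.cos_two_mul]
  nlinarith [Real.cos_le_one ⟪x, u⟫, sq_nonneg (1 - Real.cos ⟪x, u⟫)]

/-- The symmetrization of `μ`: the law of `Y - X` for independent `X`, `Y` with law `μ`. -/
noncomputable def symmetrization (μ : Measure V) : Measure V :=
  (μ.map (fun x ↦ (-1 : ℝ) • x)).conv μ

instance (μ : Measure V) [IsProbabilityMeasure μ] : IsProbabilityMeasure (symmetrization μ) := by
  have : IsProbabilityMeasure (μ.map (fun x ↦ (-1 : ℝ) • x)) :=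
    Measure.isProbabilityMeasure_map (by fun_prop)
  unfold symmetrization; infer_instance

lemma charFun_symmetrization (μ : Measure V) [IsProbabilityMeasure μ] (u : V) :
    charFun (symmetrization μ) u = ((‖charFun μ u‖ ^ 2 : ℝ) : ℂ) := by
  have : IsProbabilityMeasure (μ.map (fun x ↦ (-1 : ℝ) • x)) :=
    Measure.isProbabilityMeasure_map (by fun_prop)
  rw [symmetrization, charFun_conv, charFun_map_smul, neg_one_smul, charFun_neg, mul_comm,
    Complex.mul_conj, Complex.normSq_eq_norm_sq]

lemma one_sub_norm_sq_charFun_two_smul_le (μ : Measure V) [IsProbabilityMeasure μ] (u : V) :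
    1 - ‖charFun μ ((2 : ℝ) • u)‖ ^ 2 ≤ 4 * (1 - ‖charFun μ u‖ ^ 2) := by
  have h := one_sub_re_charFun_two_smul_le (symmetrization μ) u
  rw [charFun_symmetrization, charFun_symmetrization] at h
  simpa only [Complex.ofReal_re] using h

/-- Split the integral of `1 - exp (i ⟪x, u⟫)` over `K` and `Kᶜ`. -/
lemma norm_one_sub_charFun_le (μ : Measure V) [IsProbabilityMeasure μ] {K : Set V}
    (hK : MeasurableSet K) {u : V} {p : ℝ} (hp : ∀ x ∈ K, |⟪x, u⟫| ≤ p) (hp0 : 0 ≤ p) :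
    ‖1 - charFun μ u‖ ≤ 2 * μ.real Kᶜ + p := by
  have h1 : 1 - charFun μ u = ∫ x, (1 - exp (⟪x, u⟫ * I)) ∂μ := by
    rw [integral_sub (integrable_const _) (integrable_exp_inner μ u), charFun_apply]
    simp
  have hint : Integrable (fun x : V ↦ 1 - exp (⟪x, u⟫ * I)) μ :=
    (integrable_const _).sub (integrable_exp_inner μ u)
  have hi2 : Integrable (fun x : V ↦ Kᶜ.indicator (fun _ ↦ (2 : ℝ)) x + p) μ :=
    ((integrable_const _).indicator hK.compl).add (integrable_const _)
  calc ‖1 - charFun μ u‖ ≤ ∫ x, ‖1 - exp (⟪x, u⟫ * I)‖ ∂μ := by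
        rw [h1]; exact norm_integral_le_integral_norm _
    _ ≤ ∫ x, (Kᶜ.indicator (fun _ ↦ (2 : ℝ)) x + p) ∂μ := by
        refine integral_mono hint.norm hi2 fun x ↦ ?_
        by_cases hx : x ∈ K
        · have := Real.norm_exp_I_mul_ofReal_sub_one_le (x := ⟪x, u⟫)
          simp only [Set.indicator, Set.mem_compl_iff, hx, not_true_eq_false, if_false, zero_add]
          rw [norm_sub_rev, mul_comm]
          exact this.trans (hp x hx)
        · simp only [Set.indicator, Set.mem_compl_iff, hx, not_false_eq_true, if_true]
          have := norm_sub_le (1 : ℂ) (exp (⟪x, u⟫ * I))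
          rw [norm_exp_ofReal_mul_I, norm_one] at this
          linarith
    _ = 2 * μ.real Kᶜ + p := by
        rw [integral_add ((integrable_const _).indicator hK.compl) (integrable_const _),
          integral_indicator hK.compl]
        simp [mul_comm]

omit [SecondCountableTopology V] in
lemma integrableOn_inner_sq (μ : Measure V) [IsFiniteMeasure μ] {K : Set V} (hK : IsCompact K)
    (u : V) : IntegrableOn (fun x ↦ ⟪x, u⟫ ^ 2) K μ :=
  ContinuousOn.integrableOn_compact hK (by fun_prop)

/-- The splitting over `K` and `Kᶜ` with the quadratic bound `1 - cos y ≤ y² / 2` on `K`. -/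
lemma one_sub_re_charFun_le (μ : Measure V) [IsProbabilityMeasure μ] {K : Set V}
    (hK : IsCompact K) (u : V) :
    1 - (charFun μ u).re ≤ 2 * μ.real Kᶜ + (∫ x in K, ⟪x, u⟫ ^ 2 ∂μ) / 2 := by
  have hKm := hK.measurableSet
  have hi1 : Integrable (fun x : V ↦ 1 - Real.cos ⟪x, u⟫) μ :=
    (integrable_const _).sub (integrable_cos_inner μ u)
  rw [one_sub_re_charFun, ← integral_add_compl hKm hi1, add_comm]
  refine add_le_add ?_ ?_
  · calc ∫ x in Kᶜ, (1 - Real.cos ⟪x, u⟫) ∂μ ≤ ∫ x in Kᶜ, (2 : ℝ) ∂μ :=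
          integral_mono hi1.integrableOn (integrable_const _) fun x ↦ by
            linarith [Real.neg_one_le_cos ⟪x, u⟫]
      _ = 2 * μ.real Kᶜ := by simp [mul_comm]
  · rw [← integral_div]
    refine integral_mono hi1.integrableOn ((integrableOn_inner_sq μ hK u).div_const _) fun x ↦ ?_
    have := Real.one_sub_sq_div_two_le_cos (x := ⟪x, u⟫)
    simp only
    linarith

end CharFun

/-! ### Characteristic exponents of infinitely divisible measures -/

section Exponent

variable {V : Type*} [NormedAddCommGroup V] [InnerProductSpace ℝ V] [MeasurableSpace V]
  [BorelSpace V] [SecondCountableTopology V]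

/-- `η` is a characteristic exponent of the infinitely divisible measure `μ`: a continuous function
with `η 0 = 0` such that, for every `n ≥ 1`, `exp (η / n)` is the characteristic function of a
probability measure, and for `n = 1` it is that of `μ`. -/
structure IsCharExponent (μ : ProbabilityMeasure V) (η : V → ℂ) : Prop where
  continuous : Continuous η
  map_zero : η 0 = 0
  charFun_eq : ∀ u, charFun (μ : Measure V) u = exp (η u)
  exists_root : ∀ n : ℕ, 1 ≤ n →
    ∃ ν : ProbabilityMeasure V, ∀ u, charFun (ν : Measure V) u = exp (η u / n)

lemma charFun_coe_conv (μ ν : ProbabilityMeasure V) (u : V) :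
    charFun (conv μ ν : Measure V) u = charFun (μ : Measure V) u * charFun (ν : Measure V) u :=
  charFun_conv u

omit [SecondCountableTopology V] in
lemma charFun_diracProba_zero (u : V) : charFun (diracProba (0 : V) : Measure V) u = 1 := by
  change charFun (Measure.dirac (0 : V)) u = 1
  simp [charFun_dirac]

lemma charFun_convFin (n : ℕ) (p : Fin n → ProbabilityMeasure V) (u : V) :
    charFun (convFin n p : Measure V) u = ∏ i, charFun (p i : Measure V) u := by
  unfold convFin
  induction n with
  | zero => simp [charFun_diracProba_zero]
  | succ n ih =>
    rw [List.ofFn_succ, List.foldr_cons, charFun_coe_conv, ih, Fin.prod_univ_succ]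

lemma probabilityMeasure_ext_of_charFun [CompleteSpace V] {μ ν : ProbabilityMeasure V}
    (h : ∀ u, charFun (μ : Measure V) u = charFun (ν : Measure V) u) : μ = ν :=
  Subtype.ext (Measure.ext_of_charFun (μ := (μ : Measure V)) (ν := (ν : Measure V)) (funext h))

/-- Zeros do not appear under doubling: if `φ_μ v ≠ 0`, then `|φ_ν v|²` is close to `1` for a
convolution root `ν` of high order, so `1 - |φ_ν (2 v)|² ≤ 4 (1 - |φ_ν v|²) < 1`. Every `u` is
reached by doubling from a neighbourhood of `0`. -/
lemma IsInfinitelyDivisible.charFun_ne_zero {μ : ProbabilityMeasure V}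
    (hμ : IsInfinitelyDivisible μ) (u : V) : charFun (μ : Measure V) u ≠ 0 := by
  have key : ∀ v : V, charFun (μ : Measure V) v ≠ 0 →
      charFun (μ : Measure V) ((2 : ℝ) • v) ≠ 0 := by
    intro v hv h0
    have ha : 0 < ‖charFun (μ : Measure V) v‖ ^ 2 := by positivity
    obtain ⟨n, hn⟩ := exists_pow_lt_of_lt_one ha (show (3 / 4 : ℝ) < 1 by norm_num)
    obtain ⟨ν, hν⟩ := hμ (n + 1) (by omega)
    have hpow : ∀ w, charFun (ν : Measure V) w ^ (n + 1) = charFun (μ : Measure V) w := by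
      intro w
      rw [← hν, charFun_convFin]
      simp
    have hν0 : charFun (ν : Measure V) ((2 : ℝ) • v) = 0 := by
      have := hpow ((2 : ℝ) • v)
      rw [h0] at this
      exact eq_zero_of_pow_eq_zero this
    have hd := one_sub_norm_sq_charFun_two_smul_le (ν : Measure V) v
    rw [hν0] at hd
    have hb : ‖charFun (ν : Measure V) v‖ ^ 2 ≤ 3 / 4 := by
      norm_num at hd; linarith
    have hb' : ‖charFun (μ : Measure V) v‖ ^ 2 = (‖charFun (ν : Measure V) v‖ ^ 2) ^ (n + 1) := by
      rw [← hpow v, norm_pow, ← pow_mul, ← pow_mul, mul_comm]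
    have h1 : (‖charFun (ν : Measure V) v‖ ^ 2) ^ (n + 1) ≤ (3 / 4 : ℝ) ^ (n + 1) :=
      pow_le_pow_left₀ (by positivity) hb _
    have h2 : (3 / 4 : ℝ) ^ (n + 1) ≤ (3 / 4 : ℝ) ^ n :=
      pow_le_pow_of_le_one (by norm_num) (by norm_num) (by omega)
    linarith
  have hlim : Tendsto (fun k : ℕ ↦ charFun (μ : Measure V) (((1 / 2 : ℝ) ^ k) • u)) atTop
      (𝓝 (charFun (μ : Measure V) ((0 : ℝ) • u))) :=
    (continuous_charFun.tendsto _).comp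
      ((tendsto_pow_atTop_nhds_zero_of_lt_one (by norm_num) (by norm_num)).smul_const u)
  have hne : charFun (μ : Measure V) ((0 : ℝ) • u) ≠ 0 := by simp [charFun_zero]
  obtain ⟨k, hk⟩ := (hlim.eventually_ne hne).exists
  have hind : ∀ j : ℕ, charFun (μ : Measure V) (((2 : ℝ) ^ j * (1 / 2 : ℝ) ^ k) • u) ≠ 0 := by
    intro j
    induction j with
    | zero => simpa using hk
    | succ j ih =>
      have := key _ ih
      rwa [smul_smul, ← mul_assoc, ← pow_succ'] at this
  have := hind k
  rwa [← mul_pow, mul_one_div_cancel two_ne_zero, one_pow, one_smul] at this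

omit [MeasurableSpace V] [BorelSpace V] [SecondCountableTopology V] in
/-- Continuous `n`-th roots of `exp η` on `V` are determined by their value at `0`, because `V` is
connected and the `n`-th roots of unity are discrete. -/
lemma eq_exp_div_of_pow_eq {f η : V → ℂ} (hf : Continuous f) (hη : Continuous η) (hη0 : η 0 = 0)
    (hf0 : f 0 = 1) {n : ℕ} (hn : 1 ≤ n) (h : ∀ u, f u ^ n = exp (η u)) (u : V) :
    f u = exp (η u / n) := by
  have hn0 : (n : ℂ) ≠ 0 := by exact_mod_cast (by omega : n ≠ 0)
  have hfin : {z : ℂ | z ^ n = 1}.Finite := by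
    refine (Polynomial.nthRoots n (1 : ℂ)).toFinset.finite_toSet.subset fun z hz ↦ ?_
    simpa [Polynomial.mem_nthRoots (show 0 < n by omega)] using hz
  have hg : Continuous fun v ↦ f v * exp (-(η v / n)) := by fun_prop
  have hmaps : Set.MapsTo (fun v ↦ f v * exp (-(η v / n))) Set.univ {z : ℂ | z ^ n = 1} := by
    intro v _
    change (f v * exp (-(η v / n))) ^ n = 1
    rw [mul_pow, h, ← Complex.exp_nat_mul, ← Complex.exp_add]
    rw [show η v + n * -(η v / n) = 0 by field_simp; ring, Complex.exp_zero]
  have hconst := isPreconnected_univ.constant_of_mapsTo hfin.isDiscrete hg.continuousOn hmaps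
    (Set.mem_univ u) (Set.mem_univ 0)
  simp only [hf0, hη0, zero_div, neg_zero, Complex.exp_zero, mul_one] at hconst
  rw [← mul_one (f u), ← Complex.exp_zero, ← neg_add_cancel (η u / n), Complex.exp_add, ← mul_assoc,
    hconst, one_mul]

/-- The exponent is a lift of the nonvanishing characteristic function through the covering `exp`,
and its fractions belong to the convolution roots by `eq_exp_div_of_pow_eq`. -/
lemma IsInfinitelyDivisible.exists_isCharExponent {μ : ProbabilityMeasure V}
    (hμ : IsInfinitelyDivisible μ) : ∃ η, IsCharExponent μ η := by
  let f : C(V, {z : ℂ // z ≠ 0}) :=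
    ⟨fun u ↦ ⟨charFun (μ : Measure V) u, hμ.charFun_ne_zero u⟩,
      continuous_charFun.subtype_mk _⟩
  obtain ⟨F, ⟨hF0, hF⟩, -⟩ := Complex.isCoveringMap_exp.existsUnique_continuousMap_lifts f 0 0
    (Subtype.ext (by simp [f, charFun_zero]))
  have hexp : ∀ u, charFun (μ : Measure V) u = exp (F u) := fun u ↦
    (congrArg Subtype.val (congrFun hF u)).symm
  refine ⟨F, F.continuous, hF0, hexp, fun n hn ↦ ?_⟩
  obtain ⟨ν, hν⟩ := hμ n hn
  refine ⟨ν, eq_exp_div_of_pow_eq continuous_charFun F.continuous hF0 (by simp [charFun_zero]) hn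
    fun u ↦ ?_⟩
  rw [← hexp, ← hν, charFun_convFin]
  simp

/-- `n (exp (z / n) - 1) → z`. -/
lemma tendsto_mul_exp_div_sub_one (z : ℂ) :
    Tendsto (fun n : ℕ ↦ (n : ℂ) * (exp (z / n) - 1)) atTop (𝓝 z) := by
  have hd : HasDerivAt (fun w : ℂ ↦ exp (w * z)) z 0 := by
    simpa using ((hasDerivAt_id (0 : ℂ)).mul_const z).cexp
  have hn : Tendsto (fun n : ℕ ↦ (n : ℂ)⁻¹) atTop (𝓝[≠] 0) := by
    refine tendsto_nhdsWithin_iff.2 ⟨tendsto_inv_atTop_nhds_zero_nat, ?_⟩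
    filter_upwards [eventually_ge_atTop 1] with n hn
    exact inv_ne_zero (by exact_mod_cast (by omega : n ≠ 0))
  refine (hd.tendsto_slope_zero.comp hn).congr fun n ↦ ?_
  simp [div_eq_inv_mul]

/-- The real part of `-η` grows at most quadratically along rays, as it is the limit of
`n (1 - Re exp (η / n))`, and `1 - cos (2 x) ≤ 4 (1 - cos x)`. -/
lemma IsCharExponent.neg_re_two_smul_le {μ : ProbabilityMeasure V} {η : V → ℂ}
    (h : IsCharExponent μ η) (u : V) : -(η ((2 : ℝ) • u)).re ≤ 4 * -(η u).re := by
  have hl : ∀ v : V, Tendsto (fun n : ℕ ↦ (n : ℝ) * (1 - (exp (η v / n)).re)) atTop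
      (𝓝 (-(η v).re)) := by
    intro v
    have := ((Complex.continuous_re.tendsto _).comp (tendsto_mul_exp_div_sub_one (η v))).neg
    refine this.congr fun n ↦ ?_
    simp [← Complex.ofReal_natCast]
    ring
  refine le_of_tendsto_of_tendsto (hl _) ((hl u).const_mul 4) ?_
  filter_upwards [eventually_ge_atTop 1] with n hn
  obtain ⟨ν, hν⟩ := h.exists_root n hn
  have := one_sub_re_charFun_two_smul_le (ν : Measure V) u
  rw [hν, hν] at this
  have hn0 : (0 : ℝ) ≤ n := by positivity
  nlinarith

end Exponent

/-! ### Bounds on the exponent -/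

section ExponentBounds

variable {V : Type*} [NormedAddCommGroup V] [InnerProductSpace ℝ V] [MeasurableSpace V]
  [BorelSpace V] [SecondCountableTopology V] {μ : ProbabilityMeasure V} {η : V → ℂ}

/-- Along the segment from `0` to `u` the characteristic function stays in the disc of radius `1/2`
about `1`, so `η u` is the principal logarithm of the characteristic function at `u`. -/
lemma IsCharExponent.norm_le (h : IsCharExponent μ η) {K : Set V} (hK : MeasurableSet K) {u : V}
    {p : ℝ} (hp : ∀ x ∈ K, |⟪x, u⟫| ≤ p) (hp0 : 0 ≤ p)
    (hsmall : 2 * (μ : Measure V).real Kᶜ + p ≤ 1 / 2) :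
    ‖η u‖ ≤ 3 / 2 * (2 * (μ : Measure V).real Kᶜ + p) := by
  have hbound : ∀ s ∈ Set.Icc (0 : ℝ) 1,
      ‖1 - exp (η (s • u))‖ ≤ 2 * (μ : Measure V).real Kᶜ + p := by
    intro s hs
    rw [← h.charFun_eq]
    refine norm_one_sub_charFun_le (μ : Measure V) hK (fun x hx ↦ ?_) hp0
    rw [real_inner_smul_right, abs_mul, abs_of_nonneg hs.1]
    exact (mul_le_of_le_one_left (abs_nonneg _) hs.2).trans (hp x hx)
  -- Otherwise the imaginary part takes the value `± π / 2` along the segment, where the real part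
  -- of the characteristic function would vanish.
  have him : |(η u).im| < Real.pi / 2 := by
    by_contra! hc
    have hcont : ContinuousOn (fun s : ℝ ↦ |(η (s • u)).im|) (Set.Icc 0 1) := by
      have := h.continuous
      fun_prop
    have hmem : Real.pi / 2 ∈ Set.Icc |(η ((0 : ℝ) • u)).im| |(η ((1 : ℝ) • u)).im| := by
      simpa [h.map_zero] using ⟨by positivity, hc⟩
    obtain ⟨s, hs, hs'⟩ := intermediate_value_Icc zero_le_one hcont hmem
    have hre : (exp (η (s • u))).re = 0 := by
      rw [Complex.exp_re, ← Real.cos_abs]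
      simp only at hs'
      rw [hs', Real.cos_pi_div_two, mul_zero]
    have h1 := (Complex.abs_re_le_norm (1 - exp (η (s • u)))).trans (hbound s hs)
    simp only [Complex.sub_re, Complex.one_re, hre, sub_zero, abs_one] at h1
    linarith
  have hlog : Complex.log (exp (η u)) = η u := by
    rw [abs_lt] at him
    exact Complex.log_exp (by linarith [Real.pi_pos]) (by linarith [Real.pi_pos])
  have h1 := hbound 1 ⟨zero_le_one, le_rfl⟩
  rw [one_smul, norm_sub_rev] at h1
  have h2 := Complex.norm_log_one_add_half_le_self (h1.trans hsmall)
  rw [add_sub_cancel, hlog] at h2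
  linarith

lemma neg_le_two_mul_of_one_sub_le_exp {x w : ℝ} (hw : w ≤ 1 / 2) (hw0 : 0 ≤ w)
    (h : 1 - w ≤ Real.exp x) :
    -x ≤ 2 * w := by
  have hpos : 0 < 1 - w := by linarith
  have h1 := Real.one_sub_inv_le_log_of_pos hpos
  have h2 := (Real.log_le_iff_le_exp hpos).2 h
  have h3 : (1 - w)⁻¹ ≤ 1 + 2 * w := by
    rw [inv_le_iff_one_le_mul₀ hpos]
    nlinarith
  linarith

omit [MeasurableSpace V] [BorelSpace V] [SecondCountableTopology V] in
/-- A function growing at most quadratically under doubling, and bounded by `a + b q` where the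
quadratic quantity `q` is small, is bounded by `a + (b + 4 a / c) q` everywhere. -/
lemma le_of_two_smul_le {f q : V → ℝ} {a b c : ℝ} (ha : 0 ≤ a) (hc : 0 < c)
    (hq0 : ∀ u, 0 ≤ q u) (hf : ∀ u, f ((2 : ℝ) • u) ≤ 4 * f u)
    (hq : ∀ u, q ((2 : ℝ) • u) = 4 * q u) (h : ∀ u, q u ≤ c → f u ≤ a + b * q u) (u : V) :
    f u ≤ a + (b + 4 * a / c) * q u := by
  have key : ∀ n : ℕ, ∀ u, q u ≤ 4 ^ n * c → c < q u → f u ≤ (b + 4 * a / c) * q u := by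
    intro n
    induction n with
    | zero => intro u h1 h2; simp at h1; linarith
    | succ n ih =>
      intro u h1 h2
      have hu : (2 : ℝ) • ((1 / 2 : ℝ) • u) = u := by rw [smul_smul]; norm_num
      have hfu := hf ((1 / 2 : ℝ) • u)
      have hqu := hq ((1 / 2 : ℝ) • u)
      rw [hu] at hfu hqu
      rcases le_or_gt (q ((1 / 2 : ℝ) • u)) c with hle | hgt
      · have h3 := h _ hle
        have h4 : 4 * a ≤ 4 * a / c * q u := by
          rw [div_mul_eq_mul_div, le_div_iff₀ hc]
          exact mul_le_mul_of_nonneg_left h2.le (by positivity)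
        have h5 : b * q u = 4 * (b * q ((1 / 2 : ℝ) • u)) := by rw [hqu]; ring
        rw [add_mul]
        linarith
      · have h3 := ih ((1 / 2 : ℝ) • u) (by rw [pow_succ] at h1; linarith) hgt
        have h5 : (b + 4 * a / c) * q u = 4 * ((b + 4 * a / c) * q ((1 / 2 : ℝ) • u)) := by
          rw [hqu]; ring
        linarith
  rcases le_or_gt (q u) c with hle | hgt
  · have h1 := h u hle
    have h2 : 0 ≤ 4 * a / c * q u := mul_nonneg (by positivity) (hq0 u)
    linarith
  · obtain ⟨n, hn⟩ := pow_unbounded_of_one_lt (q u / c) (show (1 : ℝ) < 4 by norm_num)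
    have := key n u (by rw [div_lt_iff₀ hc] at hn; exact hn.le) hgt
    linarith

/-- The quadratic bound on the real part of the exponent by the second moments of `μ` on a compact
set of almost full measure. -/
lemma IsCharExponent.neg_re_le (h : IsCharExponent μ η) {K : Set V} (hK : IsCompact K) {ε : ℝ}
    (hε : ε ≤ 1 / 8) (hKε : (μ : Measure V).real Kᶜ ≤ ε) (u : V) :
    -(η u).re ≤ 4 * ε + 5 * ∫ x in K, ⟪x, u⟫ ^ 2 ∂(μ : Measure V) := by
  have hε0 : 0 ≤ ε := measureReal_nonneg.trans hKε
  have hq0 : ∀ u : V, 0 ≤ ∫ x in K, ⟪x, u⟫ ^ 2 ∂(μ : Measure V) := fun u ↦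
    integral_nonneg fun x ↦ sq_nonneg _
  have := le_of_two_smul_le (f := fun u ↦ -(η u).re)
    (q := fun u ↦ ∫ x in K, ⟪x, u⟫ ^ 2 ∂(μ : Measure V)) (a := 4 * ε) (b := 1) (c := 1 / 2)
    (by positivity) (by norm_num) hq0 h.neg_re_two_smul_le
    (fun u ↦ by
      rw [← integral_const_mul]
      refine integral_congr_ae (ae_of_all _ fun x ↦ ?_)
      simp only [real_inner_smul_right]
      ring)
    (fun u hu ↦ by
      have h1 := one_sub_re_charFun_le (μ : Measure V) hK u
      have h2 : (charFun (μ : Measure V) u).re ≤ Real.exp (η u).re := by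
        rw [h.charFun_eq, ← Complex.norm_exp]
        exact Complex.re_le_norm _
      have := neg_le_two_mul_of_one_sub_le_exp (x := (η u).re)
        (w := 2 * ε + (∫ x in K, ⟪x, u⟫ ^ 2 ∂(μ : Measure V)) / 2) (by linarith)
        (by linarith [hq0 u]) (by linarith)
      linarith) u
  have h3 : (1 + 4 * (4 * ε) / (1 / 2)) * ∫ x in K, ⟪x, u⟫ ^ 2 ∂(μ : Measure V)
      ≤ 5 * ∫ x in K, ⟪x, u⟫ ^ 2 ∂(μ : Measure V) :=
    mul_le_mul_of_nonneg_right (by linarith) (hq0 u)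
  linarith

end ExponentBounds

/-! ### Gaussian averages of characteristic functions -/

section GaussianAverage

variable {V : Type*} [NormedAddCommGroup V] [InnerProductSpace ℝ V] [MeasurableSpace V]
  [BorelSpace V] [SecondCountableTopology V]
  {E : Type*} [NormedAddCommGroup E] [InnerProductSpace ℝ E] [FiniteDimensional ℝ E]
  [MeasurableSpace E] [BorelSpace E]

lemma integral_inner_sq_stdGaussian (y : E) : ∫ g, ⟪y, g⟫ ^ 2 ∂(stdGaussian E) = ‖y‖ ^ 2 := by
  have h := variance_dual_stdGaussian (innerSL ℝ y)
  rw [variance_of_integral_eq_zero (by fun_prop) (integral_strongDual_stdGaussian _)] at h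
  simpa using h

lemma integrable_norm_sq_stdGaussian : Integrable (fun g ↦ ‖g‖ ^ 2) (stdGaussian E) :=
  (IsGaussian.memLp_two_id (μ := stdGaussian E)).integrable_norm_pow (by norm_num)

/-- Averaging `1 - Re φ` over a standard Gaussian vector in `E`, transported to `V` by the adjoint
`A` of `P`. -/
lemma integral_one_sub_re_charFun_stdGaussian (ν : Measure V) [IsProbabilityMeasure ν]
    (P : V →L[ℝ] E) (A : E →L[ℝ] V) (hPA : ∀ x g, ⟪x, A g⟫ = ⟪P x, g⟫) :
    ∫ g, (1 - (charFun ν (A g)).re) ∂(stdGaussian E) =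
      ∫ x, (1 - Real.exp (-‖P x‖ ^ 2 / 2)) ∂ν := by
  have hcos : ∀ x, ∫ g, Real.cos ⟪P x, g⟫ ∂(stdGaussian E) = Real.exp (-‖P x‖ ^ 2 / 2) := by
    intro x
    have h := re_charFun (stdGaussian E) (P x)
    simp_rw [real_inner_comm (P x)] at h
    rw [← h, charFun_stdGaussian]
    norm_cast
  simp_rw [one_sub_re_charFun, hPA]
  rw [integral_integral_swap]
  · refine integral_congr_ae (ae_of_all _ fun x ↦ ?_)
    simp only
    rw [integral_sub (integrable_const _), hcos]
    · simp
    · simp_rw [real_inner_comm _ (P x)]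
      exact integrable_cos_inner _ _
  · refine (integrable_const (2 : ℝ)).mono' ?_ (ae_of_all _ fun z ↦ ?_)
    · exact Continuous.aestronglyMeasurable (by simp only [Function.uncurry_def]; fun_prop)
    · simp only [Function.uncurry_def, Real.norm_eq_abs, abs_le]
      constructor <;> linarith [Real.neg_one_le_cos ⟪P z.2, z.1⟫, Real.cos_le_one ⟪P z.2, z.1⟫]

/-- If `1 - Re φ_ν` is dominated by a constant plus the quadratic form of second moments of `m`,
then the Gaussian average turns the quadratic form into the trace of its compression by `P`. -/
lemma integral_one_sub_exp_le (ν : Measure V) [IsProbabilityMeasure ν] (m : Measure V)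
    [IsFiniteMeasure m] {a d : ℝ}
    (h : ∀ u, 1 - (charFun ν u).re ≤ a + ∫ x, ⟪x, u⟫ ^ 2 ∂m)
    (P : V →L[ℝ] E) (A : E →L[ℝ] V) (hPA : ∀ x g, ⟪x, A g⟫ = ⟪P x, g⟫)
    (hd : ∀ᵐ x ∂m, ‖P x‖ ≤ d) :
    ∫ x, (1 - Real.exp (-‖P x‖ ^ 2 / 2)) ∂ν ≤ a + m.real Set.univ * d ^ 2 := by
  rw [← integral_one_sub_re_charFun_stdGaussian ν P A hPA]
  have hint : Integrable (Function.uncurry fun (g : E) (x : V) ↦ ⟪P x, g⟫ ^ 2)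
      ((stdGaussian E).prod m) := by
    have h1 : Integrable (fun z : E × V ↦ d ^ 2 * ‖z.1‖ ^ 2) ((stdGaussian E).prod m) :=
      (integrable_norm_sq_stdGaussian.const_mul (d ^ 2)).comp_fst m
    refine h1.mono' ?_ ?_
    · exact Continuous.aestronglyMeasurable (by simp only [Function.uncurry_def]; fun_prop)
    · filter_upwards [Measure.quasiMeasurePreserving_snd.ae hd] with z hz
      simp only [Function.uncurry_def, norm_pow, Real.norm_eq_abs]
      rw [← mul_pow]
      refine pow_le_pow_left₀ (abs_nonneg _) ((abs_real_inner_le_norm _ _).trans ?_) 2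
      exact mul_le_mul_of_nonneg_right hz (norm_nonneg _)
  have hint2 : Integrable (fun g ↦ ∫ x, ⟪P x, g⟫ ^ 2 ∂m) (stdGaussian E) := hint.integral_prod_left
  have hcont : Continuous fun g ↦ 1 - (charFun ν (A g)).re := by fun_prop
  have hint3 : Integrable (fun g ↦ 1 - (charFun ν (A g)).re) (stdGaussian E) := by
    refine (integrable_const (2 : ℝ)).mono' hcont.aestronglyMeasurable (ae_of_all _ fun g ↦ ?_)
    have h1 := (Complex.abs_re_le_norm _).trans (norm_charFun_le_one (μ := ν) (A g))
    rw [abs_le] at h1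
    rw [Real.norm_eq_abs, abs_le]
    constructor <;> linarith
  calc ∫ g, (1 - (charFun ν (A g)).re) ∂(stdGaussian E)
      ≤ ∫ g, (a + ∫ x, ⟪P x, g⟫ ^ 2 ∂m) ∂(stdGaussian E) := by
        refine integral_mono hint3 ((integrable_const _).add hint2) fun g ↦ ?_
        simpa only [hPA] using h (A g)
    _ = a + ∫ x, ‖P x‖ ^ 2 ∂m := by
        rw [integral_add (integrable_const _) hint2, integral_integral_swap hint]
        simp [integral_inner_sq_stdGaussian]
    _ ≤ a + ∫ x, d ^ 2 ∂m := by
        have hb : ∀ᵐ x ∂m, ‖P x‖ ^ 2 ≤ d ^ 2 := by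
          filter_upwards [hd] with x hx
          exact pow_le_pow_left₀ (norm_nonneg _) hx 2
        have hi : Integrable (fun x ↦ ‖P x‖ ^ 2) m := by
          refine (integrable_const (d ^ 2)).mono'
            (Continuous.aestronglyMeasurable (by fun_prop)) ?_
          filter_upwards [hb] with x hx
          simpa using hx
        exact add_le_add le_rfl (integral_mono_ae hi (integrable_const _) hb)
    _ = a + m.real Set.univ * d ^ 2 := by simp

/-- Chebyshev form of the Gaussian average: `1 - exp (-t² / 2) ≥ 1 / 2` for `t ≥ 2`. -/
lemma measureReal_norm_ge_le (ν : Measure V) [IsProbabilityMeasure ν] (m : Measure V)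
    [IsFiniteMeasure m] {a d δ : ℝ} (hδ : 0 < δ)
    (h : ∀ u, 1 - (charFun ν u).re ≤ a + ∫ x, ⟪x, u⟫ ^ 2 ∂m)
    (P : V →L[ℝ] E) (A : E →L[ℝ] V) (hPA : ∀ x g, ⟪x, A g⟫ = ⟪P x, g⟫)
    (hd : ∀ᵐ x ∂m, ‖P x‖ ≤ d) :
    ν.real {x | δ ≤ ‖P x‖} ≤ 2 * a + 8 * m.real Set.univ * (d / δ) ^ 2 := by
  have hs : 0 < 2 / δ := by positivity
  have hnorm : ∀ x, ‖((2 / δ) • P) x‖ = 2 / δ * ‖P x‖ := fun x ↦ by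
    rw [_root_.smul_apply, norm_smul, Real.norm_of_nonneg hs.le]
  have h1 := integral_one_sub_exp_le ν m h ((2 / δ) • P) ((2 / δ) • A) (d := 2 / δ * d)
    (fun x g ↦ by simp [real_inner_smul_left, real_inner_smul_right, hPA]) (by
      filter_upwards [hd] with x hx
      rw [hnorm]
      exact mul_le_mul_of_nonneg_left hx hs.le)
  have hmeas : MeasurableSet {x | δ ≤ ‖P x‖} :=
    (isClosed_le continuous_const (by fun_prop)).measurableSet
  have hint : Integrable (fun x ↦ 1 - Real.exp (-‖((2 / δ) • P) x‖ ^ 2 / 2)) ν := by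
    refine (integrable_const (1 : ℝ)).mono' (Continuous.aestronglyMeasurable (by fun_prop))
      (ae_of_all _ fun x ↦ ?_)
    have e1 := Real.exp_pos (-‖((2 / δ) • P) x‖ ^ 2 / 2)
    have e2 : Real.exp (-‖((2 / δ) • P) x‖ ^ 2 / 2) ≤ 1 :=
      Real.exp_le_one_iff.2 (by have := sq_nonneg ‖((2 / δ) • P) x‖; linarith)
    rw [Real.norm_eq_abs, abs_le]
    constructor <;> linarith
  have h2 : ν.real {x | δ ≤ ‖P x‖} * (1 / 2) ≤
      ∫ x, (1 - Real.exp (-‖((2 / δ) • P) x‖ ^ 2 / 2)) ∂ν := by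
    have : ν.real {x | δ ≤ ‖P x‖} * (1 / 2) =
        ∫ x, {x | δ ≤ ‖P x‖}.indicator (fun _ ↦ (1 / 2 : ℝ)) x ∂ν := by
      rw [integral_indicator hmeas]; simp
    rw [this]
    refine integral_mono ((integrable_const _).indicator hmeas) hint fun x ↦ ?_
    by_cases hx : δ ≤ ‖P x‖
    · simp only [Set.indicator, Set.mem_ofPred_eq, hx, if_true]
      have h2le : 2 ≤ ‖((2 / δ) • P) x‖ := by
        rw [hnorm, div_mul_eq_mul_div, le_div_iff₀ hδ]
        linarith
      have : Real.exp (-‖((2 / δ) • P) x‖ ^ 2 / 2) ≤ 1 / 2 := by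
        rw [neg_div, Real.exp_neg, inv_le_comm₀ (Real.exp_pos _) (by norm_num)]
        have := Real.add_one_le_exp (‖((2 / δ) • P) x‖ ^ 2 / 2)
        nlinarith
      linarith
    · simp only [Set.indicator, Set.mem_ofPred_eq, hx, if_false]
      have : Real.exp (-‖((2 / δ) • P) x‖ ^ 2 / 2) ≤ 1 :=
        Real.exp_le_one_iff.2 (by have := sq_nonneg ‖((2 / δ) • P) x‖; linarith)
      linarith
  have h3 : 2 * (m.real Set.univ * (2 / δ * d) ^ 2) = 8 * m.real Set.univ * (d / δ) ^ 2 := by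
    ring
  linarith

end GaussianAverage

/-! ### Compact sets and finite-dimensional subspaces -/

section Projections

variable {V : Type*} [NormedAddCommGroup V] [InnerProductSpace ℝ V]

/-- A compact set is contained in a small neighbourhood of a finite-dimensional subspace, spanned by
finitely many of its points. -/
lemma exists_finiteDimensional_approx {K : Set V} (hK : IsCompact K) {δ : ℝ} (hδ : 0 < δ) :
    ∃ F : Submodule ℝ V, FiniteDimensional ℝ F ∧ F ≤ Submodule.span ℝ K ∧
      ∀ x ∈ K, ∃ y ∈ F, ‖x - y‖ ≤ δ := by
  obtain ⟨t, htK, htfin, ht⟩ := hK.finite_cover_balls hδ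
  refine ⟨Submodule.span ℝ t, FiniteDimensional.span_of_finite ℝ htfin,
    Submodule.span_mono htK, fun x hx ↦ ?_⟩
  obtain ⟨y, hy, hxy⟩ := Set.mem_iUnion₂.1 (ht hx)
  refine ⟨y, Submodule.subset_span hy, ?_⟩
  rw [← dist_eq_norm]
  exact (Metric.mem_ball.1 hxy).le

lemma norm_orthogonal_starProjection_le (F : Submodule ℝ V) [F.HasOrthogonalProjection]
    {x y : V} (hy : y ∈ F) : ‖Fᗮ.starProjection x‖ ≤ ‖x - y‖ := by
  have h : Fᗮ.starProjection (x - y) = Fᗮ.starProjection x := by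
    rw [map_sub, Submodule.starProjection_orthogonal_apply_eq_zero hy, sub_zero]
  rw [← h]
  exact Submodule.norm_starProjection_apply_le _ _

/-- A closed bounded set lying within any prescribed distance of some finite-dimensional subspace is
compact. -/
lemma isCompact_of_finiteDimensional_approx [CompleteSpace V] {D : Set V} (hD : IsClosed D)
    {R : ℝ} (hR : ∀ x ∈ D, ‖x‖ ≤ R)
    (h : ∀ δ > 0, ∃ F : Submodule ℝ V, ∃ _ : FiniteDimensional ℝ F,
      ∀ x ∈ D, ‖Fᗮ.starProjection x‖ ≤ δ) : IsCompact D := by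
  refine TotallyBounded.isCompact_of_isClosed (Metric.totallyBounded_iff.2 fun ε hε ↦ ?_) hD
  obtain ⟨F, hF, hFD⟩ := h (ε / 2) (by positivity)
  have hB : IsCompact ((↑) '' (Metric.closedBall (0 : F) R) : Set V) :=
    (isCompact_closedBall _ _).image continuous_subtype_val
  obtain ⟨t, htfin, ht⟩ := Metric.totallyBounded_iff.1 hB.totallyBounded (ε / 2) (by positivity)
  refine ⟨t, htfin, fun x hx ↦ ?_⟩
  have hmem : F.starProjection x ∈ ((↑) '' (Metric.closedBall (0 : F) R) : Set V) := by
    refine ⟨⟨F.starProjection x, Submodule.starProjection_apply_mem F x⟩, ?_, rfl⟩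
    rw [mem_closedBall_zero_iff]
    exact (Submodule.norm_starProjection_apply_le F x).trans (hR x hx)
  obtain ⟨y, hy, hxy⟩ := Set.mem_iUnion₂.1 (ht hmem)
  refine Set.mem_iUnion₂.2 ⟨y, hy, ?_⟩
  rw [Metric.mem_ball, dist_eq_norm] at hxy ⊢
  have hsum : x = F.starProjection x + Fᗮ.starProjection x :=
    (Submodule.starProjection_add_starProjection_orthogonal (K := F) x).symm
  calc ‖x - y‖ = ‖(F.starProjection x - y) + Fᗮ.starProjection x‖ := by
        conv_lhs => rw [hsum]
        congr 1; abel
    _ ≤ ‖F.starProjection x - y‖ + ‖Fᗮ.starProjection x‖ := norm_add_le _ _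
    _ < ε := by linarith [hFD x hx]

/-- The polar-type hull of a compact set `K`: the points `z` with `|⟪z, u⟫| ≤ c` as soon as
`|⟪·, u⟫| ≤ r` on `K`. It is compact. -/
lemma isCompact_polar_hull [CompleteSpace V] {K : Set V} (hK : IsCompact K) {r c : ℝ} (hr : 0 < r)
    (hc : 0 < c) : IsCompact {z : V | ∀ u : V, (∀ y ∈ K, |⟪y, u⟫| ≤ r) → |⟪z, u⟫| ≤ c} := by
  have hclosed : IsClosed {z : V | ∀ u : V, (∀ y ∈ K, |⟪y, u⟫| ≤ r) → |⟪z, u⟫| ≤ c} := by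
    simp only [Set.ofPred_forall]
    exact isClosed_iInter fun u ↦ isClosed_iInter fun _ ↦
      isClosed_le (by fun_prop) continuous_const
  -- Test the defining condition on `u` proportional to the component of `z` orthogonal to `F`.
  have key : ∀ (F : Submodule ℝ V) (_ : FiniteDimensional ℝ F) (δ : ℝ), 0 < δ →
      (∀ y ∈ K, ‖Fᗮ.starProjection y‖ ≤ δ) →
      ∀ z ∈ {z : V | ∀ u : V, (∀ y ∈ K, |⟪y, u⟫| ≤ r) → |⟪z, u⟫| ≤ c},
        ‖Fᗮ.starProjection z‖ ≤ c * δ / r := by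
    intro F _ δ hδ hF z hz
    rcases eq_or_ne (Fᗮ.starProjection z) 0 with h0 | h0
    · rw [h0, norm_zero]; positivity
    have hpos : 0 < ‖Fᗮ.starProjection z‖ := norm_pos_iff.2 h0
    have hin : ∀ y, ⟪y, Fᗮ.starProjection z⟫ = ⟪Fᗮ.starProjection y, Fᗮ.starProjection z⟫ := by
      intro y
      rw [Submodule.inner_starProjection_left_eq_right,
        Submodule.starProjection_eq_self_iff.2 (Submodule.starProjection_apply_mem _ _)]
    have hs : 0 ≤ r / (δ * ‖Fᗮ.starProjection z‖) := by positivity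
    have := hz ((r / (δ * ‖Fᗮ.starProjection z‖)) • Fᗮ.starProjection z) fun y hy ↦ by
      rw [real_inner_smul_right, abs_mul, abs_of_nonneg hs, hin, div_mul_eq_mul_div,
        div_le_iff₀ (by positivity)]
      refine mul_le_mul_of_nonneg_left ((abs_real_inner_le_norm _ _).trans ?_) hr.le
      exact mul_le_mul_of_nonneg_right (hF y hy) hpos.le
    rw [real_inner_smul_right, abs_mul, abs_of_nonneg hs, hin, real_inner_self_eq_norm_sq,
      abs_of_nonneg (sq_nonneg _), div_mul_eq_mul_div, div_le_iff₀ (by positivity)] at this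
    rw [le_div_iff₀ hr]
    have h2 : ‖Fᗮ.starProjection z‖ * (‖Fᗮ.starProjection z‖ * r) ≤
        ‖Fᗮ.starProjection z‖ * (c * δ) := by nlinarith
    exact le_of_mul_le_mul_left h2 hpos
  obtain ⟨R, hR⟩ := hK.isBounded.exists_norm_le
  refine isCompact_of_finiteDimensional_approx hclosed (R := c * (max R 1) / r) (fun z hz ↦ ?_)
    fun δ hδ ↦ ?_
  · have := key ⊥ inferInstance (max R 1) (by positivity) (fun y hy ↦
      (Submodule.norm_starProjection_apply_le _ _).trans ((hR y hy).trans (le_max_left _ _))) z hz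
    rwa [show (⊥ : Submodule ℝ V)ᗮ.starProjection z = z from
      Submodule.starProjection_eq_self_iff.2 (by simp)] at this
  · obtain ⟨F, hF, -, hFK⟩ := exists_finiteDimensional_approx hK (δ := δ * r / c) (by positivity)
    refine ⟨F, hF, fun z hz ↦ ?_⟩
    have := key F hF (δ * r / c) (by positivity) (fun y hy ↦ by
      obtain ⟨w, hw, hyw⟩ := hFK y hy
      exact (norm_orthogonal_starProjection_le F hw).trans hyw) z hz
    rwa [show c * (δ * r / c) / r = δ by field_simp] at this

end Projections

/-! ### Tightness in a Hilbert space -/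

section Tightness

variable {V : Type*} [NormedAddCommGroup V] [InnerProductSpace ℝ V] [CompleteSpace V]
  [MeasurableSpace V] [BorelSpace V] [SecondCountableTopology V]

omit [NormedAddCommGroup V] [InnerProductSpace ℝ V] [CompleteSpace V] [BorelSpace V]
  [SecondCountableTopology V] in
lemma measure_le_of_measureReal_le {ν : Measure V} [IsFiniteMeasure ν] {A : Set V} {e : ℝ≥0}
    (h : ν.real A ≤ e) : ν A ≤ e := by
  rw [← ENNReal.ofReal_coe_nnreal]
  exact (ENNReal.le_ofReal_iff_toReal_le (measure_ne_top _ _) e.2).2 h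

omit [InnerProductSpace ℝ V] [CompleteSpace V] [BorelSpace V] [SecondCountableTopology V] in
lemma isTightMeasureSet_iff_measureReal {S : Set (ProbabilityMeasure V)} :
    IsTightMeasureSet {((μ : ProbabilityMeasure V) : Measure V) | μ ∈ S} ↔
      ∀ ε > (0 : ℝ), ∃ K : Set V, IsCompact K ∧ ∀ μ ∈ S, (μ : Measure V).real Kᶜ ≤ ε := by
  rw [isTightMeasureSet_iff_exists_isCompact_measure_compl_le]
  constructor
  · intro h ε hε
    obtain ⟨K, hK, h2⟩ := h (ENNReal.ofReal ε) (by simpa using hε)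
    exact ⟨K, hK, fun μ hμ ↦ ENNReal.toReal_le_of_le_ofReal hε.le (h2 _ ⟨μ, hμ, rfl⟩)⟩
  · intro h ε hε
    obtain ⟨δ, hδ0, hδ⟩ := ENNReal.lt_iff_exists_nnreal_btwn.1 hε
    obtain ⟨K, hK, h2⟩ := h δ (by exact_mod_cast hδ0)
    refine ⟨K, hK, ?_⟩
    rintro _ ⟨μ, hμ, rfl⟩
    refine le_trans ?_ hδ.le
    exact measure_le_of_measureReal_le (h2 μ hμ)

/-- The Gaussian bound for the component in a subspace `W` that need not be finite-dimensional: up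
to small mass, `ν` lives on a compact set, on which the projection to `W` is close to a projection
to a finite-dimensional subspace of `W`. -/
lemma measureReal_norm_starProjection_ge_le (ν : Measure V) [IsProbabilityMeasure ν]
    (m : Measure V) [IsFiniteMeasure m] {a d δ : ℝ} (hδ : 0 < δ)
    (h : ∀ u, 1 - (charFun ν u).re ≤ a + ∫ x, ⟪x, u⟫ ^ 2 ∂m)
    (W : Submodule ℝ V) [W.HasOrthogonalProjection] (hd : ∀ᵐ x ∂m, ‖W.starProjection x‖ ≤ d) :
    ν.real {x | 2 * δ ≤ ‖W.starProjection x‖} ≤ 2 * a + 8 * m.real Set.univ * (d / δ) ^ 2 := by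
  refine le_of_forall_pos_le_add fun ε hε ↦ ?_
  obtain ⟨L, hL, hLε⟩ := isTightMeasureSet_iff_exists_isCompact_measure_compl_le.1
    (isTightMeasureSet_singleton (μ := ν)) (ENNReal.ofReal ε) (by simpa using hε)
  have hLε : ν.real Lᶜ ≤ ε := ENNReal.toReal_le_of_le_ofReal hε.le (hLε ν rfl)
  obtain ⟨G, hG, hGW, hGL⟩ := exists_finiteDimensional_approx
    (hL.image W.starProjection.continuous) hδ
  have hGle : G ≤ W := hGW.trans (Submodule.span_le.2 (by
    rintro _ ⟨x, -, rfl⟩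
    exact Submodule.starProjection_apply_mem W x))
  have hcomp : ∀ x, G.starProjection (W.starProjection x) = G.starProjection x := fun x ↦
    congrArg (fun f : V →L[ℝ] V ↦ f x) (Submodule.starProjection_comp_starProjection_of_le hGle)
  have hnorm : ∀ x, ‖G.orthogonalProjectionOnto x‖ = ‖G.starProjection x‖ := fun x ↦ rfl
  have h1 := measureReal_norm_ge_le ν m (d := d) hδ h G.orthogonalProjectionOnto G.subtypeL
    (fun x g ↦ by simp) (by
      filter_upwards [hd] with x hx
      rw [hnorm, ← hcomp]
      exact (Submodule.norm_starProjection_apply_le _ _).trans hx)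
  have hsub : {x | 2 * δ ≤ ‖W.starProjection x‖} ⊆
      {x | δ ≤ ‖G.orthogonalProjectionOnto x‖} ∪ Lᶜ := by
    intro x hx
    by_cases hxL : x ∈ L
    · left
      obtain ⟨y, hy, hxy⟩ := hGL _ (Set.mem_image_of_mem _ hxL)
      have h2 := (norm_orthogonal_starProjection_le G hy).trans hxy
      have h3 : ‖W.starProjection x‖ ≤
          ‖G.starProjection (W.starProjection x)‖ + ‖Gᗮ.starProjection (W.starProjection x)‖ := by
        conv_lhs => rw [← Submodule.starProjection_add_starProjection_orthogonal (K := G)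
          (W.starProjection x)]
        exact norm_add_le _ _
      have hx' : 2 * δ ≤ ‖W.starProjection x‖ := hx
      change δ ≤ _
      rw [hnorm, ← hcomp]
      linarith
    · exact Or.inr hxL
  calc ν.real {x | 2 * δ ≤ ‖W.starProjection x‖}
      ≤ ν.real ({x | δ ≤ ‖G.orthogonalProjectionOnto x‖} ∪ Lᶜ) := measureReal_mono hsub
    _ ≤ ν.real {x | δ ≤ ‖G.orthogonalProjectionOnto x‖} + ν.real Lᶜ := measureReal_union_le _ _
    _ ≤ _ := by linarith

omit [SecondCountableTopology V] [BorelSpace V] in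
/-- Tightness in a Hilbert space: uniformly small mass far from the origin, and far from suitable
finite-dimensional subspaces. -/
lemma isTightMeasureSet_of_finiteDimensional_approx {S : Set (ProbabilityMeasure V)}
    (hR : ∀ ε > (0 : ℝ), ∃ R : ℝ, ∀ ν ∈ S, (ν : Measure V).real {x | R ≤ ‖x‖} ≤ ε)
    (h : ∀ ε > (0 : ℝ), ∀ δ > (0 : ℝ), ∃ F : Submodule ℝ V, ∃ _ : FiniteDimensional ℝ F,
      ∀ ν ∈ S, (ν : Measure V).real {x | δ ≤ ‖Fᗮ.starProjection x‖} ≤ ε) :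
    IsTightMeasureSet {((μ : ProbabilityMeasure V) : Measure V) | μ ∈ S} := by
  rw [isTightMeasureSet_iff_exists_isCompact_measure_compl_le]
  intro ε hε
  obtain ⟨e, he0, hesum⟩ := ENNReal.exists_pos_sum_of_countable (ENNReal.half_pos hε.ne').ne' ℕ
  obtain ⟨e', he'0, he'⟩ := ENNReal.lt_iff_exists_nnreal_btwn.1 (ENNReal.half_pos hε.ne')
  obtain ⟨R, hR⟩ := hR e' (by exact_mod_cast he'0)
  choose F hF hFS using fun j : ℕ ↦ h (e j) (by exact_mod_cast he0 j) (1 / (j + 1)) (by positivity)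
  let D : Set V := {x | ‖x‖ ≤ R} ∩ ⋂ j, {x | ‖(F j)ᗮ.starProjection x‖ ≤ 1 / ((j : ℝ) + 1)}
  have hD : IsClosed D := (isClosed_le (by fun_prop) continuous_const).inter
    (isClosed_iInter fun j ↦ isClosed_le (by fun_prop) continuous_const)
  refine ⟨D, isCompact_of_finiteDimensional_approx hD (fun x hx ↦ hx.1) fun δ hδ ↦ ?_, ?_⟩
  · obtain ⟨j, hj⟩ := exists_nat_one_div_lt hδ
    exact ⟨F j, hF j, fun x hx ↦ (Set.mem_iInter.1 hx.2 j).trans hj.le⟩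
  · rintro _ ⟨ν, hν, rfl⟩
    have hsub : Dᶜ ⊆ {x | R ≤ ‖x‖} ∪
        ⋃ j : ℕ, {x | 1 / ((j : ℝ) + 1) ≤ ‖(F j)ᗮ.starProjection x‖} := by
      intro x hx
      by_contra hc
      simp only [Set.mem_union, Set.mem_iUnion, Set.mem_ofPred_eq, not_or, not_exists,
        not_le] at hc
      exact hx ⟨hc.1.le, Set.mem_iInter.2 fun j ↦ (hc.2 j).le⟩
    calc (ν : Measure V) Dᶜ
        ≤ (ν : Measure V) {x | R ≤ ‖x‖} +
          ∑' j : ℕ, (ν : Measure V) {x | 1 / ((j : ℝ) + 1) ≤ ‖(F j)ᗮ.starProjection x‖} :=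
          (measure_mono hsub).trans ((measure_union_le _ _).trans
            (add_le_add le_rfl (measure_iUnion_le _)))
      _ ≤ e' + ∑' j, (e j : ℝ≥0∞) :=
          add_le_add (measure_le_of_measureReal_le (hR ν hν))
            (ENNReal.tsum_le_tsum fun j ↦ measure_le_of_measureReal_le (hFS j ν hν))
      _ ≤ ε / 2 + ε / 2 := add_le_add he'.le hesum.le
      _ = ε := ENNReal.add_halves ε

end Tightness

/-! ### Tightness of the generated family -/

section Main

variable {V : Type*} [NormedAddCommGroup V] [InnerProductSpace ℝ V] [MeasurableSpace V]
  [BorelSpace V] [SecondCountableTopology V]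
  {J : Type*} {μ : J → ProbabilityMeasure V} {η : J → V → ℂ}

/-- The probability measures with characteristic function `exp (∑ t i * η (α i))` for finitely many
times `t i ≥ 0` of total length at most `T`. -/
def exponentFamily (η : J → V → ℂ) (T : ℝ) : Set (ProbabilityMeasure V) :=
  {ν | ∃ (n : ℕ) (α : Fin n → J) (t : Fin n → ℝ≥0), ∑ i, (t i : ℝ) ≤ T ∧
    ∀ u, charFun (ν : Measure V) u = exp (∑ i, (t i : ℂ) * η (α i) u)}

/-- The quadratic bounds on the exponents add up: the measure `m` collects the restrictions to `K`
of the `μ (α i)`, weighted by the times `t i`. -/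
lemma exists_measure_one_sub_re_charFun_symmetrization_le (hμ : ∀ α, IsCharExponent (μ α) (η α))
    {K : Set V} (hK : IsCompact K) {ε : ℝ} (hε : ε ≤ 1 / 8) (hε0 : 0 ≤ ε)
    (hKε : ∀ α, (μ α : Measure V).real Kᶜ ≤ ε) {T : ℝ} {ν : ProbabilityMeasure V}
    (hν : ν ∈ exponentFamily η T) :
    ∃ m : Measure V, IsFiniteMeasure m ∧ m Kᶜ = 0 ∧ m.real Set.univ ≤ 10 * T ∧
      ∀ u, 1 - (charFun (symmetrization (ν : Measure V)) u).re ≤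
        8 * T * ε + ∫ x, ⟪x, u⟫ ^ 2 ∂m := by
  obtain ⟨n, α, t, ht, hch⟩ := hν
  refine ⟨∑ i, (10 * t i) • (μ (α i) : Measure V).restrict K, inferInstance, ?_, ?_, fun u ↦ ?_⟩
  · simp [Measure.restrict_apply hK.measurableSet.compl]
  · rw [measureReal_def, Measure.finsetSum_apply, ENNReal.toReal_sum (by finiteness)]
    calc ∑ i, (((10 * t i) • (μ (α i) : Measure V).restrict K) Set.univ).toReal
        ≤ ∑ i, 10 * (t i : ℝ) := by
          refine Finset.sum_le_sum fun i _ ↦ ?_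
          have h1 : (μ (α i) : Measure V).real K ≤ 1 := measureReal_le_one
          have h2 : (((10 * t i) • (μ (α i) : Measure V).restrict K) Set.univ).toReal =
              10 * (t i : ℝ) * (μ (α i) : Measure V).real K := by
            rw [Measure.smul_apply]
            simp [ENNReal.smul_def, measureReal_def]
          rw [h2]
          exact mul_le_of_le_one_right (by positivity) h1
      _ ≤ 10 * T := by rw [← Finset.mul_sum]; linarith
  · have hsum : ‖charFun (ν : Measure V) u‖ ^ 2 =
        Real.exp (-(2 * ∑ i, (t i : ℝ) * -(η (α i) u).re)) := by
      rw [hch, Complex.norm_exp, ← Real.exp_nat_mul]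
      congr 1
      simp [Complex.re_sum, Finset.sum_neg_distrib]
    have hint : ∫ x, ⟪x, u⟫ ^ 2 ∂(∑ i, (10 * t i) • (μ (α i) : Measure V).restrict K) =
        ∑ i, 10 * (t i : ℝ) * ∫ x in K, ⟪x, u⟫ ^ 2 ∂(μ (α i) : Measure V) := by
      rw [integral_finsetSum_measure fun i _ ↦
        Integrable.smul_measure_nnreal (integrableOn_inner_sq _ hK u)]
      refine Finset.sum_congr rfl fun i _ ↦ ?_
      rw [integral_smul_nnreal_measure]
      simp [NNReal.smul_def]
    rw [charFun_symmetrization, Complex.ofReal_re, hsum, hint]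
    calc 1 - Real.exp (-(2 * ∑ i, (t i : ℝ) * -(η (α i) u).re))
        ≤ 2 * ∑ i, (t i : ℝ) * -(η (α i) u).re := by
          have := Real.add_one_le_exp (-(2 * ∑ i, (t i : ℝ) * -(η (α i) u).re))
          linarith
      _ ≤ 2 * ∑ i, (t i : ℝ) * (4 * ε + 5 * ∫ x in K, ⟪x, u⟫ ^ 2 ∂(μ (α i) : Measure V)) := by
          gcongr with i
          exact (hμ (α i)).neg_re_le hK hε (hKε _) u
      _ = 8 * (∑ i, (t i : ℝ)) * ε +
          ∑ i, 10 * (t i : ℝ) * ∫ x in K, ⟪x, u⟫ ^ 2 ∂(μ (α i) : Measure V) := by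
          rw [Finset.mul_sum, Finset.mul_sum, Finset.sum_mul, ← Finset.sum_add_distrib]
          exact Finset.sum_congr rfl fun i _ ↦ by ring
      _ ≤ _ := by gcongr

/-- The symmetrization as a probability measure. -/
noncomputable def symmetrizationProba (ν : ProbabilityMeasure V) : ProbabilityMeasure V :=
  ⟨symmetrization (ν : Measure V), inferInstance⟩

lemma isTightMeasureSet_symmetrizationProba_exponentFamily [CompleteSpace V]
    (hμ : ∀ α, IsCharExponent (μ α) (η α))
    (htight : IsTightMeasureSet {((ν : ProbabilityMeasure V) : Measure V) | ν ∈ Set.range μ})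
    {T : ℝ} (hT : 0 ≤ T) :
    IsTightMeasureSet
      {((ν : ProbabilityMeasure V) : Measure V) |
        ν ∈ symmetrizationProba '' exponentFamily η T} := by
  rw [isTightMeasureSet_iff_measureReal] at htight
  -- The bound on the mass of `{2 δ ≤ ‖W.starProjection x‖}`, for `W` nearly orthogonal to `K`.
  have key : ∀ ε > (0 : ℝ), ∃ K : Set V, IsCompact K ∧ ∀ (W : Submodule ℝ V)
      (_ : W.HasOrthogonalProjection) (d δ : ℝ), 0 < δ → (∀ x ∈ K, ‖W.starProjection x‖ ≤ d) →
      80 * T * (d / δ) ^ 2 ≤ ε / 2 → ∀ ν ∈ symmetrizationProba '' exponentFamily η T,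
        (ν : Measure V).real {x | 2 * δ ≤ ‖W.starProjection x‖} ≤ ε := by
    intro ε hε
    -- The constant `8 T ε'` in the bound for `1 - φ` then contributes at most `ε / 2`.
    set ε' := min (1 / 8) (ε / (32 * (T + 1))) with hε'
    have hε'0 : 0 < ε' := by positivity
    obtain ⟨K, hK, hKε⟩ := htight ε' hε'0
    refine ⟨K, hK, fun W _ d δ hδ hd hsmall ↦ ?_⟩
    rintro _ ⟨ν, hν, rfl⟩
    obtain ⟨m, hm, hmK, hmT, hbound⟩ := exists_measure_one_sub_re_charFun_symmetrization_le hμ hK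
      (min_le_left _ _) hε'0.le (fun α ↦ hKε _ ⟨α, rfl⟩) hν
    have h1 := measureReal_norm_starProjection_ge_le (symmetrization (ν : Measure V)) m hδ
      hbound W (d := d) (by
        have : ∀ᵐ x ∂m, x ∈ K := by rwa [ae_iff]
        filter_upwards [this] with x hx using hd x hx)
    have h2 : 8 * m.real Set.univ * (d / δ) ^ 2 ≤ 80 * T * (d / δ) ^ 2 :=
      mul_le_mul_of_nonneg_right (by linarith) (sq_nonneg _)
    have h3 : 2 * (8 * T * ε') ≤ ε / 2 := by
      have h4 : ε' ≤ ε / (32 * (T + 1)) := min_le_right _ _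
      rw [le_div_iff₀ (by positivity)] at h4
      nlinarith
    exact h1.trans (by linarith)
  refine isTightMeasureSet_of_finiteDimensional_approx (fun ε hε ↦ ?_) fun ε hε δ hδ ↦ ?_
  · obtain ⟨K, hK, hKν⟩ := key ε hε
    obtain ⟨d, hd⟩ := hK.isBounded.exists_norm_le
    -- Here `W = ⊤`, and `δ` is so large that `80 T (d / δ)² ≤ ε / 2`.
    set δ := max 1 (160 * T * d ^ 2 / ε) with hδ
    have hδ1 : 1 ≤ δ := le_max_left _ _
    have hδ2 : 160 * T * d ^ 2 / ε ≤ δ := le_max_right _ _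
    refine ⟨2 * δ, fun ν hν ↦ ?_⟩
    have := hKν ⊤ inferInstance d δ (by linarith) (fun x hx ↦ by
      rw [Submodule.starProjection_top]; exact hd x hx) (by
        rw [div_le_iff₀ hε] at hδ2
        rw [div_pow, ← mul_div_assoc, div_le_iff₀ (by positivity)]
        have := mul_le_mul_of_nonneg_right (show δ ≤ δ ^ 2 by nlinarith) hε.le
        linarith) ν hν
    simpa [Submodule.starProjection_top] using this
  · obtain ⟨K, hK, hKν⟩ := key ε hε
    obtain ⟨d, hd0, hd⟩ : ∃ d > 0, 80 * T * (d / (δ / 2)) ^ 2 ≤ ε / 2 := by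
      have hlim : Tendsto (fun d : ℝ ↦ 80 * T * (d / (δ / 2)) ^ 2) (𝓝[>] 0) (𝓝 0) := by
        have : Continuous fun d : ℝ ↦ 80 * T * (d / (δ / 2)) ^ 2 := by fun_prop
        simpa using (this.tendsto 0).mono_left nhdsWithin_le_nhds
      obtain ⟨d, h1, h2⟩ := ((hlim.eventually_le_const (half_pos hε)).and
        self_mem_nhdsWithin).exists
      exact ⟨d, h2, h1⟩
    obtain ⟨F, hF, -, hFK⟩ := exists_finiteDimensional_approx hK hd0
    refine ⟨F, hF, fun ν hν ↦ ?_⟩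
    have := hKν Fᗮ inferInstance d (δ / 2) (by positivity) (fun x hx ↦ by
      obtain ⟨w, hw, hxw⟩ := hFK x hx
      exact (norm_orthogonal_starProjection_le F hw).trans hxw) hd ν hν
    simpa [mul_div_cancel₀] using this

/-- The mass of `A` under the symmetrization of `ν` is an average of the masses of `A` under
translates of `ν`. -/
lemma exists_translate_measure_le (ν : Measure V) [IsProbabilityMeasure ν]
    {A : Set V} (hA : MeasurableSet A) :
    ∃ z : V, (ν.map (z + ·)).real A ≤ (symmetrization ν).real A := by
  have hprob : IsProbabilityMeasure (ν.map (fun x ↦ (-1 : ℝ) • x)) :=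
    Measure.isProbabilityMeasure_map (by fun_prop)
  have h : symmetrization ν A = ∫⁻ z, (ν.map (z + ·)) A ∂(ν.map (fun x ↦ (-1 : ℝ) • x)) := by
    rw [symmetrization, ← lintegral_indicator_one hA,
      Measure.lintegral_conv (measurable_one.indicator hA)]
    refine lintegral_congr fun z ↦ ?_
    rw [Measure.map_apply (by fun_prop) hA, ← lintegral_indicator_one
      (measurable_const_add z hA)]
    rfl
  have hmeas : Measurable fun z ↦ (ν.map (z + ·)) A := by
    have : (fun z ↦ (ν.map (z + ·)) A) =
        fun z ↦ ν (Prod.mk z ⁻¹' ((fun p : V × V ↦ p.1 + p.2) ⁻¹' A)) := by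
      funext z
      rw [Measure.map_apply (by fun_prop) hA]
      rfl
    rw [this]
    exact measurable_measure_prodMk_left (measurable_add hA)
  obtain ⟨z, hz⟩ := exists_le_lintegral (μ := ν.map (fun x ↦ (-1 : ℝ) • x)) hmeas.aemeasurable
  exact ⟨z, ENNReal.toReal_mono (measure_ne_top _ _) (hz.trans h.ge)⟩

/-- If `|y| > π`, then `s y = ± π` for some `s ∈ [0, 1]`, where `|1 - exp (i s y)| = 2`. -/
lemma abs_le_pi_of_norm_one_sub_exp_le {y : ℝ}
    (h : ∀ s ∈ Set.Icc (0 : ℝ) 1, ‖1 - exp ((s * y : ℝ) * I)‖ ≤ 1) : |y| ≤ Real.pi := by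
  by_contra! hc
  have hy : 0 < |y| := Real.pi_pos.trans hc
  have h1 := h (Real.pi / |y|) ⟨by positivity, (div_le_one hy).2 hc.le⟩
  have h2 := (Complex.abs_re_le_norm _).trans h1
  rw [Complex.sub_re, Complex.one_re, Complex.exp_ofReal_mul_I_re, ← Real.cos_abs, abs_mul,
    abs_of_pos (by positivity : 0 < Real.pi / |y|), div_mul_cancel₀ _ hy.ne', Real.cos_pi] at h2
  norm_num at h2

/-- The exponents themselves are small where `|⟪·, u⟫|` is small on a large compact set, uniformly;
this controls the translations needed to centre the members of the family. -/
lemma norm_one_sub_charFun_exponentFamily_le (hμ : ∀ α, IsCharExponent (μ α) (η α)) {K : Set V}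
    (hK : MeasurableSet K) {r T : ℝ} (hT : 0 ≤ T) (hr0 : 0 ≤ r) (hr : r ≤ 1 / (24 * (T + 1)))
    (hKr : ∀ α, (μ α : Measure V).real Kᶜ ≤ r) {ν : ProbabilityMeasure V}
    (hν : ν ∈ exponentFamily η T) {u : V} (hu : ∀ y ∈ K, |⟪y, u⟫| ≤ r) :
    ‖1 - charFun (ν : Measure V) u‖ ≤ 1 / 2 := by
  obtain ⟨n, α, t, ht, hch⟩ := hν
  rw [le_div_iff₀ (by positivity)] at hr
  have hrT : 0 ≤ r * T := by positivity
  have hη : ∀ i, ‖η (α i) u‖ ≤ 9 / 2 * r := fun i ↦ by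
    have h1 := (hμ (α i)).norm_le hK hu hr0 (by linarith [hKr (α i)])
    linarith [hKr (α i)]
  have hsum : ‖∑ i, (t i : ℂ) * η (α i) u‖ ≤ 1 / 4 := by
    calc ‖∑ i, (t i : ℂ) * η (α i) u‖ ≤ ∑ i, (t i : ℝ) * (9 / 2 * r) := by
          refine norm_sum_le_of_le _ fun i _ ↦ ?_
          rw [norm_mul]
          refine mul_le_mul ?_ (hη i) (norm_nonneg _) (t i).2
          simp
      _ = (∑ i, (t i : ℝ)) * (9 / 2 * r) := by rw [Finset.sum_mul]
      _ ≤ T * (9 / 2 * r) := by gcongr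
      _ ≤ 1 / 4 := by linarith
  rw [hch, norm_sub_rev]
  exact (Complex.norm_exp_sub_one_le (by linarith)).trans (by linarith)

/-- The symmetrizations are tight, so each member of the family is concentrated near a translate of
a fixed compact set; closeness of the characteristic functions to `1` confines the translation. -/
theorem isTightMeasureSet_exponentFamily [CompleteSpace V]
    (hμ : ∀ α, IsCharExponent (μ α) (η α))
    (htight : IsTightMeasureSet {((ν : ProbabilityMeasure V) : Measure V) | ν ∈ Set.range μ})
    {T : ℝ} (hT : 0 ≤ T) :
    IsTightMeasureSet {((ν : ProbabilityMeasure V) : Measure V) | ν ∈ exponentFamily η T} := by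
  have hsymm := isTightMeasureSet_symmetrizationProba_exponentFamily hμ htight hT
  rw [isTightMeasureSet_iff_measureReal] at htight hsymm ⊢
  intro ε hε
  obtain ⟨K₁, hK₁, hKsymm⟩ := hsymm (min ε (1 / 8)) (by positivity)
  -- With this `r` the exponents `∑ t i * η (α i) u` are at most `1 / 4` in modulus.
  set r := 1 / (24 * (T + 1)) with hr
  have hr0 : 0 < r := by positivity
  have hr8 : r ≤ 1 / 8 := by
    rw [hr, div_le_div_iff₀ (by positivity) (by norm_num)]; linarith
  obtain ⟨K₂, hK₂, hKμ⟩ := htight r hr0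
  set D := {z : V | ∀ u : V, (∀ y ∈ K₁ ∪ K₂, |⟪y, u⟫| ≤ r) → |⟪z, u⟫| ≤ Real.pi} with hDdef
  have hD : IsCompact D := isCompact_polar_hull (hK₁.union hK₂) hr0 Real.pi_pos
  refine ⟨K₁ - D, by simpa only [sub_eq_add_neg] using hK₁.add hD.neg, fun ν hν ↦ ?_⟩
  obtain ⟨z, hz⟩ := exists_translate_measure_le (ν : Measure V) hK₁.measurableSet.compl
  have hz' : ((ν : Measure V).map (z + ·)).real K₁ᶜ ≤ min ε (1 / 8) :=
    hz.trans (hKsymm _ ⟨ν, hν, rfl⟩)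
  have hprob : IsProbabilityMeasure ((ν : Measure V).map (z + ·)) :=
    Measure.isProbabilityMeasure_map (by fun_prop)
  -- For `u` in the star-shaped set defining `D`, both `φ_ν(u)` and `φ_ν(u) exp (i ⟪z, u⟫)` are
  -- close to `1`.
  have hzD : z ∈ D := by
    intro u hu
    refine abs_le_pi_of_norm_one_sub_exp_le fun s hs ↦ ?_
    have hsu : ∀ y ∈ K₁ ∪ K₂, |⟪y, s • u⟫| ≤ r := fun y hy ↦ by
      rw [real_inner_smul_right, abs_mul, abs_of_nonneg hs.1]
      exact (mul_le_of_le_one_left (abs_nonneg _) hs.2).trans (hu y hy)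
    have h1 := norm_one_sub_charFun_le ((ν : Measure V).map (z + ·)) hK₁.measurableSet
      (fun y hy ↦ hsu y (Or.inl hy)) hr0.le
    have h2 := norm_one_sub_charFun_exponentFamily_le hμ hK₂.measurableSet hT hr0.le hr.le
      (fun α ↦ hKμ _ ⟨α, rfl⟩) hν (fun y hy ↦ hsu y (Or.inr hy))
    have h3 := hz'.trans (min_le_right _ _)
    rw [charFun_map_const_add, real_inner_smul_right] at h1
    set e := exp ((s * ⟪z, u⟫ : ℝ) * I) with he
    have hen : ‖e‖ = 1 := norm_exp_ofReal_mul_I _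
    calc ‖1 - e‖ = ‖(1 - charFun (ν : Measure V) (s • u) * e) -
            (1 - charFun (ν : Measure V) (s • u)) * e‖ := by congr 1; ring
      _ ≤ ‖1 - charFun (ν : Measure V) (s • u) * e‖ +
            ‖(1 - charFun (ν : Measure V) (s • u)) * e‖ := norm_sub_le _ _
      _ ≤ (2 * (1 / 8) + r) + 1 / 2 := by
          rw [norm_mul, hen, mul_one]
          exact add_le_add (h1.trans (by linarith)) h2
      _ ≤ 1 := by linarith
  calc (ν : Measure V).real (K₁ - D)ᶜ ≤ (ν : Measure V).real ((z + ·) ⁻¹' K₁ᶜ) := by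
        refine measureReal_mono fun x hx hx' ↦ hx ?_
        have : z + x ∈ K₁ := hx'
        exact ⟨z + x, this, z, hzD, by simp⟩
    _ = ((ν : Measure V).map (z + ·)).real K₁ᶜ := by
        rw [map_measureReal_apply (by fun_prop) hK₁.measurableSet.compl]
    _ ≤ ε := hz'.trans (min_le_left _ _)

end Main

/-! ### Convolution semigroups -/

section Semigroup

variable {V : Type*} [NormedAddCommGroup V] [InnerProductSpace ℝ V] [MeasurableSpace V]
  [BorelSpace V] [SecondCountableTopology V]

omit [SecondCountableTopology V] in
lemma continuous_charFun_apply (u : V) :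
    Continuous fun ν : ProbabilityMeasure V ↦ charFun (ν : Measure V) u := by
  refine continuous_iff_continuousAt.2 fun ν ↦ ?_
  have h := tendsto_id (x := 𝓝 ν)
  rw [ProbabilityMeasure.tendsto_iff_forall_integral_rclike_tendsto ℂ] at h
  simp_rw [ContinuousAt, charFun_eq_integral_innerProbChar]
  exact h (BoundedContinuousFunction.innerProbChar u)

omit [SecondCountableTopology V] in
lemma charFun_eq_of_mapClusterPt {ι : Type*} {l : Filter ι} {f : ι → ProbabilityMeasure V}
    {ν : ProbabilityMeasure V} (hν : MapClusterPt ν l f) {u : V} {z : ℂ}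
    (hz : Tendsto (fun i ↦ charFun (f i : Measure V) u) l (𝓝 z)) :
    charFun (ν : Measure V) u = z := by
  obtain ⟨U, hU, hUν⟩ := mapClusterPt_iff_ultrafilter.1 hν
  exact tendsto_nhds_unique (((continuous_charFun_apply u).tendsto ν).comp hUν) (hz.mono_left hU)

omit [SecondCountableTopology V] in
lemma exists_charFun_eq_of_tendsto {K : Set (ProbabilityMeasure V)} (hK : IsCompact K)
    {ι : Type*} {l : Filter ι} [l.NeBot] {f : ι → ProbabilityMeasure V} (hf : ∀ i, f i ∈ K)
    {g : V → ℂ} (hg : ∀ u, Tendsto (fun i ↦ charFun (f i : Measure V) u) l (𝓝 (g u))) :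
    ∃ ν : ProbabilityMeasure V, ∀ u, charFun (ν : Measure V) u = g u := by
  obtain ⟨ν, -, hν⟩ := hK (f := l.map f) (tendsto_principal.2 (.of_forall hf))
  exact ⟨ν, fun u ↦ charFun_eq_of_mapClusterPt hν (hg u)⟩

/-- On a relatively compact set, pointwise convergence of characteristic functions implies weak
convergence. -/
lemma tendsto_of_tendsto_charFun [CompleteSpace V] {K : Set (ProbabilityMeasure V)}
    (hK : IsCompact K) {ι : Type*} {l : Filter ι} {f : ι → ProbabilityMeasure V}
    (hf : ∀ᶠ i in l, f i ∈ K) {ν : ProbabilityMeasure V}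
    (hg : ∀ u, Tendsto (fun i ↦ charFun (f i : Measure V) u) l (𝓝 (charFun (ν : Measure V) u))) :
    Tendsto f l (𝓝 ν) :=
  hK.tendsto_nhds_of_unique_mapClusterPt hf fun _ _ hν' ↦
    probabilityMeasure_ext_of_charFun fun u ↦ charFun_eq_of_mapClusterPt hν' (hg u)

lemma isCompact_closure_exponentFamily [CompleteSpace V] {J : Type*} {μ : J → ProbabilityMeasure V}
    {η : J → V → ℂ} (hμ : ∀ α, IsCharExponent (μ α) (η α))
    (hcomp : IsCompact (closure (Set.range μ))) {T : ℝ} (hT : 0 ≤ T) :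
    IsCompact (closure (exponentFamily η T)) :=
  isCompact_closure_of_isTightMeasureSet
    (isTightMeasureSet_exponentFamily hμ (isTightMeasureSet_of_isCompact_closure hcomp) hT)

omit [BorelSpace V] [SecondCountableTopology V] in
lemma mem_exponentFamily_of_charFun_eq {η : V → ℂ} {t : ℝ≥0} {T : ℝ} (ht : (t : ℝ) ≤ T)
    {ν : ProbabilityMeasure V} (hν : ∀ u, charFun (ν : Measure V) u = exp ((t : ℂ) * η u)) :
    ν ∈ exponentFamily (fun _ : Unit ↦ η) T :=
  ⟨1, fun _ ↦ (), fun _ ↦ t, by simpa using ht, fun u ↦ by simpa using hν u⟩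

lemma tendsto_floor_mul_div (t : ℝ≥0) :
    Tendsto (fun n : ℕ ↦ ((⌊(t : ℝ) * (n + 1)⌋₊ : ℝ≥0) / (n + 1 : ℝ≥0))) atTop (𝓝 t) := by
  have h1 : Tendsto (fun n : ℕ ↦ (n : ℝ) + 1) atTop atTop :=
    tendsto_atTop_add_const_right _ _ tendsto_natCast_atTop_atTop
  refine NNReal.tendsto_coe.1 (((tendsto_nat_floor_mul_div_atTop t.2).comp h1).congr fun n ↦ ?_)
  simp

lemma charFun_convFin_root {η : V → ℂ} {n : ℕ} {ν : ProbabilityMeasure V}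
    (hν : ∀ u, charFun (ν : Measure V) u = exp (η u / n)) (k : ℕ) (u : V) :
    charFun (convFin k (fun _ ↦ ν) : Measure V) u = exp (((k : ℝ≥0) / (n : ℝ≥0) : ℝ≥0) * η u) := by
  rw [charFun_convFin]
  simp only [hν, Finset.prod_const, Finset.card_univ, Fintype.card_fin, ← Complex.exp_nat_mul]
  push_cast
  congr 1
  ring

/-- Existence of real convolution powers: the rational powers are limits of convolution powers of
the roots, and a limit point exists by tightness. -/
lemma IsCharExponent.exists_charFun_eq [CompleteSpace V] {μ : ProbabilityMeasure V} {η : V → ℂ}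
    (h : IsCharExponent μ η) (t : ℝ≥0) :
    ∃ ν : ProbabilityMeasure V, ∀ u, charFun (ν : Measure V) u = exp ((t : ℂ) * η u) := by
  choose ρ hρ using fun n : ℕ ↦ h.exists_root (n + 1) (by omega)
  have hcompact := isCompact_closure_exponentFamily (μ := fun _ : Unit ↦ μ) (fun _ ↦ h)
    (by simp) t.2
  have hch := fun n : ℕ ↦ charFun_convFin_root (hρ n) ⌊(t : ℝ) * (n + 1)⌋₊
  refine exists_charFun_eq_of_tendsto (l := atTop) hcompact
    (f := fun n : ℕ ↦ convFin ⌊(t : ℝ) * (n + 1)⌋₊ (fun _ ↦ ρ n)) (fun n ↦ subset_closure ?_)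
    fun u ↦ ?_
  · refine mem_exponentFamily_of_charFun_eq ?_ (hch n)
    push_cast
    refine div_le_of_le_mul₀ (by positivity) t.2 ?_
    exact Nat.floor_le (by positivity)
  · simp_rw [hch]
    have hc : Continuous fun s : ℝ≥0 ↦ exp ((s : ℂ) * η u) := by fun_prop
    refine ((hc.tendsto t).comp (tendsto_floor_mul_div t)).congr fun n ↦ ?_
    simp

/-- The characteristic functions of any convolution semigroup through `μ` are the `exp (t η)`: this
holds at rational times by uniqueness of continuous roots, and at all times by continuity. -/
lemma IsConvSemigroupOf.charFun_eq {μ : ProbabilityMeasure V} {η : V → ℂ}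
    (h : IsCharExponent μ η) {ρ : ℝ≥0 → ProbabilityMeasure V} (hρ : IsConvSemigroupOf μ ρ)
    (t : ℝ≥0) (u : V) : charFun (ρ t : Measure V) u = exp ((t : ℂ) * η u) := by
  have hpow : ∀ (s : ℝ≥0) (k : ℕ) (v : V),
      charFun (ρ (k * s) : Measure V) v = charFun (ρ s : Measure V) v ^ k := by
    intro s k v
    induction k with
    | zero => simp [hρ.zero, charFun_diracProba_zero]
    | succ k ih => rw [Nat.cast_succ, add_one_mul, hρ.add, charFun_coe_conv, ih, pow_succ]
  have hroot : ∀ (n : ℕ) (v : V),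
      charFun (ρ (1 / (n + 1 : ℝ≥0)) : Measure V) v = exp (η v / (n + 1 : ℕ)) := by
    intro n v
    refine eq_exp_div_of_pow_eq continuous_charFun h.continuous h.map_zero (by simp [charFun_zero])
      (by omega) (fun w ↦ ?_) v
    rw [← hpow, ← h.charFun_eq]
    congr 2
    rw [← hρ.one]
    congr 1
    push_cast
    field_simp
  have hlim1 := ((continuous_charFun_apply u).comp hρ.continuous).tendsto t |>.comp
    (tendsto_floor_mul_div t)
  have hc : Continuous fun s : ℝ≥0 ↦ exp ((s : ℂ) * η u) := by fun_prop
  have hlim2 := (hc.tendsto t).comp (tendsto_floor_mul_div t)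
  refine tendsto_nhds_unique hlim1 (hlim2.congr fun n ↦ ?_)
  simp only [Function.comp_apply]
  rw [div_eq_mul_one_div, hpow, hroot, ← Complex.exp_nat_mul]
  congr 1
  push_cast
  ring

/-- The weakly continuous convolution semigroup with exponents `t η`. -/
lemma IsCharExponent.exists_isConvSemigroupOf [CompleteSpace V] {μ : ProbabilityMeasure V}
    {η : V → ℂ} (h : IsCharExponent μ η) :
    ∃ ρ : ℝ≥0 → ProbabilityMeasure V, IsConvSemigroupOf μ ρ := by
  choose ρ hρ using h.exists_charFun_eq
  refine ⟨ρ, ?_, fun s t ↦ ?_, continuous_iff_continuousAt.2 fun t ↦ ?_, ?_⟩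
  · exact probabilityMeasure_ext_of_charFun fun u ↦ by simp [hρ, charFun_diracProba_zero]
  · refine probabilityMeasure_ext_of_charFun fun u ↦ ?_
    rw [charFun_coe_conv, hρ, hρ, hρ, ← Complex.exp_add]
    push_cast
    rw [add_mul]
  · have hcompact := isCompact_closure_exponentFamily (μ := fun _ : Unit ↦ μ) (fun _ ↦ h)
      (by simp) (t + 1).2
    refine tendsto_of_tendsto_charFun hcompact ?_ fun u ↦ ?_
    · filter_upwards [eventually_le_nhds (show t < t + 1 by simp)] with s hs
      exact subset_closure (mem_exponentFamily_of_charFun_eq (NNReal.coe_le_coe.2 hs) (hρ s))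
    · simp_rw [hρ]
      have hc : Continuous fun s : ℝ≥0 ↦ exp ((s : ℂ) * η u) := by fun_prop
      exact hc.tendsto t
  · exact probabilityMeasure_ext_of_charFun fun u ↦ by simp [hρ, h.charFun_eq]

lemma IsCharExponent.existsUnique_isConvSemigroupOf [CompleteSpace V] {μ : ProbabilityMeasure V}
    {η : V → ℂ} (h : IsCharExponent μ η) :
    ∃! ρ : ℝ≥0 → ProbabilityMeasure V, IsConvSemigroupOf μ ρ := by
  obtain ⟨ρ, hρ⟩ := h.exists_isConvSemigroupOf
  refine ⟨ρ, hρ, fun ρ' hρ' ↦ funext fun t ↦ probabilityMeasure_ext_of_charFun fun u ↦ ?_⟩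
  rw [hρ.charFun_eq h, hρ'.charFun_eq h]

lemma IsCharExponent.charFun_convPow [CompleteSpace V] {μ : ProbabilityMeasure V} {η : V → ℂ}
    (h : IsCharExponent μ η) (t : ℝ≥0) (u : V) :
    charFun (convPow μ t : Measure V) u = exp ((t : ℂ) * η u) := by
  have hex := h.exists_isConvSemigroupOf
  rw [convPow, dif_pos hex]
  exact hex.choose_spec.charFun_eq h t u

end Semigroup

end InfDiv

theorem lemma5p5 {V : Type*} [NormedAddCommGroup V] [InnerProductSpace ℝ V] [CompleteSpace V]
    [SecondCountableTopology V] [MeasurableSpace V] [BorelSpace V]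
    {J : Type*} (μ : J → ProbabilityMeasure V)
    (hdiv : ∀ α, InfDiv.IsInfinitelyDivisible (μ α))
    (hcomp : IsCompact (closure (Set.range μ))) (T : ℝ) :
    (∀ α, ∃! ρ : ℝ≥0 → ProbabilityMeasure V, InfDiv.IsConvSemigroupOf (μ α) ρ) ∧
    IsCompact (closure {ν : ProbabilityMeasure V |
      ∃ (n : ℕ) (α : Fin n → J) (t : Fin n → ℝ≥0), 1 ≤ n ∧ ∑ i, (t i : ℝ) ≤ T ∧
        ν = InfDiv.convFin n (fun i => InfDiv.convPow (μ (α i)) (t i))}) := by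
  choose η hη using fun α ↦ (hdiv α).exists_isCharExponent
  refine ⟨fun α ↦ (hη α).existsUnique_isConvSemigroupOf, ?_⟩
  -- For `T < 0` the set is empty; enlarging `T` to `|T|` covers this case as well.
  refine (InfDiv.isCompact_closure_exponentFamily hη hcomp (abs_nonneg T)).of_isClosed_subset
    isClosed_closure (closure_mono ?_)
  rintro _ ⟨n, α, t, -, ht, rfl⟩
  refine ⟨n, α, t, ht.trans (le_abs_self T), fun u ↦ ?_⟩
  rw [InfDiv.charFun_convFin, Complex.exp_sum]
  exact Finset.prod_congr rfl fun i _ ↦ (hη (α i)).charFun_convPow (t i) u
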